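/- Let $L$ be a smooth operator field (a tensor field of type $(1,1)$) on an open neighbourhood of $0\in\mathbb{R}^3$ which is a Nijenhuis operator, i.e. its Nijenhuis torsion $$N_L(u,v)=L^2[u,v]+[Lu,Lv]-L[Lu,v]-L[u,Lv]$$ vanishes for all vector fields $u,v$. Define the functions $\sigma_1,\sigma_2,\sigma_3$ by the characteristic polynomial $\chi(t)=\det(t\,\mathrm{Id}-L)=t^3+\sigma_1t^2+\sigma_2t+\sigma_3$. Suppose that $d\sigma_1$ and $d\sigma_3$ are linearly independent in a neighbourhood of $0$, that $\sigma_1(0)=\sigma_3(0)=0$, and that the restriction of $\sigma_2$ to the joint level line $\{\sigma_1=0,\ \sigma_3=0\}$ (a smooth curve near $0$) has a Morse singularity at $0$, i.e. $0$ is a nondegenerate critical point of this restriction. If $\sigma_2(0)\ge 0$, then no such operator exists. If $\sigma_2(0)<0$, so that $\sigma_2(0)=-c^2$ with a real number $c\neq0$ determined up to sign, then, for one of the two choices of the sign of $c$ and for one choice of the sign $\pm$ (the same in both formulas below), there is a regular smooth change of coordinates near $0$, preserving the origin, such that in the new coordinates $(x,y,z)$ the matrix of $L$ and its characteristic polynomial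 are $$L=\begin{pmatrix}-x+c&\pm2y&\frac1c\\-\frac y2&-c&0\\-z&0&0\end{pmatrix},\qquad \chi(t)=t^3+xt^2+\Bigl(\pm y^2+cx+\frac zc-c^2\Bigr)t+z.$$ -/

import Mathlib

open scoped ContDiff Topology Matrix

/-- The Nijenhuis torsion `N_L(u, v) = L²[u, v] + [Lu, Lv] - L[Lu, v] - L[u, Lv]` of an operator
field `L`, evaluated on the vector fields `u`, `v` at the point `p`. -/
noncomputable def nijenhuisTorsion {E : Type*} [NormedAddCommGroup E] [NormedSpace ℝ E]
    (L : E → E →L[ℝ] E) (u v : E → E) (p : E) : E :=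
  L p (L p (VectorField.lieBracket ℝ u v p))
    + VectorField.lieBracket ℝ (fun q => L q (u q)) (fun q => L q (v q)) p
    - L p (VectorField.lieBracket ℝ (fun q => L q (u q)) v p)
    - L p (VectorField.lieBracket ℝ u (fun q => L q (v q)) p)

/-- `L` is a (smooth) Nijenhuis operator on the open set `U`: a smooth operator field whose
Nijenhuis torsion vanishes on all pairs of smooth vector fields on `U`. -/
structure IsNijenhuisOn {E : Type*} [NormedAddCommGroup E] [NormedSpace ℝ E]
    (L : E → E →L[ℝ] E) (U : Set E) : Prop where
  smooth : ContDiffOn ℝ ∞ L U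
  torsion_eq_zero : ∀ u v : E → E, ContDiffOn ℝ ∞ u U → ContDiffOn ℝ ∞ v U →
    ∀ p ∈ U, nijenhuisTorsion L u v p = 0

/-- The invariant `σ i` (`i = 1, 2, 3`) of a three-dimensional operator field, i.e. the function
with `det (t - L) = t ^ 3 + σ 1 * t ^ 2 + σ 2 * t + σ 3`. -/
noncomputable def charInvariant (L : (Fin 3 → ℝ) → (Fin 3 → ℝ) →L[ℝ] (Fin 3 → ℝ)) (i : ℕ)
    (p : Fin 3 → ℝ) : ℝ :=
  (LinearMap.charpoly (L p : (Fin 3 → ℝ) →ₗ[ℝ] (Fin 3 → ℝ))).coeff (3 - i)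

/-- The function `f`, restricted to the smooth curve `S`, has a Morse singularity at `p`:
in a regular smooth local parameter `s` of the curve, centred at `p`, the first derivative of
the restriction vanishes at `p` and the second one does not. (The set `S` is meant to be a smooth
curve near `p`, as is a joint level line of functions with independent differentials; a regular
smooth arc in `S` through `p` is then a local parametrization of `S`, and the condition does not
depend on its choice.) -/
def HasMorseSingularityOnCurve {E : Type*} [NormedAddCommGroup E] [NormedSpace ℝ E]
    (f : E → ℝ) (S : Set E) (p : E) : Prop :=
  ∃ γ : ℝ → E, ContDiffAt ℝ ∞ γ 0 ∧ γ 0 = p ∧ deriv γ 0 ≠ 0 ∧ (∀ᶠ s in 𝓝 (0 : ℝ), γ s ∈ S) ∧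
    deriv (fun s => f (γ s)) 0 = 0 ∧ deriv (deriv fun s => f (γ s)) 0 ≠ 0

/-- A regular (smooth) change of coordinates near `0`, defined inside `U` and fixing the origin:
a diffeomorphism from an open neighbourhood `φ.source ⊆ U` of `0` onto an open set. -/
structure IsCoordinateChange {E : Type*} [NormedAddCommGroup E] [NormedSpace ℝ E]
    (φ : OpenPartialHomeomorph E E) (U : Set E) : Prop where
  zero_mem : (0 : E) ∈ φ.source
  source_subset : φ.source ⊆ U
  map_zero : φ 0 = 0
  smooth : ContDiffOn ℝ ∞ φ φ.source
  smooth_symm : ContDiffOn ℝ ∞ φ.symm φ.target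

/-- In the coordinates given by `φ` the operator field `L` has the matrix `M`: at each point `p`
of the chart, `dφ ∘ L ∘ (dφ)⁻¹ = M (φ p)`, where matrices act on column vectors. -/
def HasMatrixInCoordinates (L : (Fin 3 → ℝ) → (Fin 3 → ℝ) →L[ℝ] (Fin 3 → ℝ))
    (φ : OpenPartialHomeomorph (Fin 3 → ℝ) (Fin 3 → ℝ))
    (M : (Fin 3 → ℝ) → Matrix (Fin 3) (Fin 3) ℝ) : Prop :=
  ∀ p ∈ φ.source, ∀ v : Fin 3 → ℝ, fderiv ℝ φ p (L p v) = M (φ p) *ᵥ fderiv ℝ φ p v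

/-! ### Characteristic polynomial of a 3×3 matrix and its coefficients -/

section Algebra

/-! Write `L^*α` for `α ∘ L`. Multiplying the torsion equation by powers of `L` and taking traces
gives, with Cayley–Hamilton, `L^*dσ₁ = dσ₂ - σ₁dσ₁`, `L^*dσ₂ = dσ₃ - σ₂dσ₁`, `L^*dσ₃ = -σ₃dσ₁`
(`IsNijenhuisOn.fderiv_one_comp` and its two companions). Nothing else is used about the torsion.

Where `σ₂` is critical along the level lines of `(σ₁, σ₃)`, one has `dσ₂ = a dσ₁ + b dσ₃`. Applying
`L^*` forces `ab = 1` and `a² - aσ₁ - bσ₃ = -σ₂` (`critical_relations`). At the origin this reads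
`σ₂ = -a²` with `a ≠ 0`, so `σ₂(0) ≥ 0` is impossible.

By the Morse condition the critical set near `0` is a surface with coordinates `x = σ₁`, `z = σ₃`,
on which `a`, `b` are the partial derivatives of `σ₂`. The two relations are then a Clairaut-type
system, and `middle_plane_rigidity` shows that `a` is a constant `c`, so `σ₂ = cx + z/c - c²` there.
Off the surface a Morse lemma with parameters adds `±y²` (`IsNijenhuisOn.exists_coordinates`).

In the coordinates `(σ₁, y, σ₃)` the first and third rows of `L` are the formulas for `L^*dσ₁`,
`L^*dσ₃`. The formula for `L^*dσ₂` gives the second row after division by `y`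
(`IsNijenhuisOn.hasMatrixInCoordinates`). -/

open Polynomial in
theorem Matrix.charpoly_fin_three {R : Type*} [CommRing R] (A : Matrix (Fin 3) (Fin 3) R) :
    A.charpoly = X ^ 3 + C (-A.trace) * X ^ 2
      + C (A 0 0 * A 1 1 - A 0 1 * A 1 0 + A 0 0 * A 2 2 - A 0 2 * A 2 0
        + A 1 1 * A 2 2 - A 1 2 * A 2 1) * X + C (-A.det) := by
  rw [Matrix.charpoly, Matrix.det_fin_three, Matrix.trace_fin_three, Matrix.det_fin_three]
  simp
  ring

open Polynomial in
theorem coeff_cubic {R : Type*} [CommRing R] (a b c : R) (p : R[X])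
    (hp : p = X ^ 3 + C a * X ^ 2 + C b * X + C c) :
    p.coeff 2 = a ∧ p.coeff 1 = b ∧ p.coeff 0 = c := by
  subst hp
  simp [coeff_X, coeff_C, coeff_X_pow]

end Algebra

/-- The matrix of an operator on `ℝ³` in the standard basis. -/
noncomputable abbrev opMatrix (T : (Fin 3 → ℝ) →L[ℝ] (Fin 3 → ℝ)) : Matrix (Fin 3) (Fin 3) ℝ :=
  LinearMap.toMatrix' (T : (Fin 3 → ℝ) →ₗ[ℝ] (Fin 3 → ℝ))

section charInvariant

variable (L : (Fin 3 → ℝ) → (Fin 3 → ℝ) →L[ℝ] (Fin 3 → ℝ)) (p : Fin 3 → ℝ)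

open Polynomial in
theorem charpoly_eq_opMatrix :
    LinearMap.charpoly (L p : (Fin 3 → ℝ) →ₗ[ℝ] (Fin 3 → ℝ)) = (opMatrix (L p)).charpoly := by
  rw [opMatrix, ← LinearMap.toMatrix_eq_toMatrix', LinearMap.charpoly_toMatrix]

theorem charInvariant_one : charInvariant L 1 p = -(opMatrix (L p)).trace := by
  rw [charInvariant, charpoly_eq_opMatrix]
  exact (coeff_cubic _ _ _ _ (Matrix.charpoly_fin_three _)).1

theorem charInvariant_two : charInvariant L 2 p =
    opMatrix (L p) 0 0 * opMatrix (L p) 1 1 - opMatrix (L p) 0 1 * opMatrix (L p) 1 0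
      + opMatrix (L p) 0 0 * opMatrix (L p) 2 2 - opMatrix (L p) 0 2 * opMatrix (L p) 2 0
      + opMatrix (L p) 1 1 * opMatrix (L p) 2 2 - opMatrix (L p) 1 2 * opMatrix (L p) 2 1 := by
  rw [charInvariant, charpoly_eq_opMatrix]
  exact (coeff_cubic _ _ _ _ (Matrix.charpoly_fin_three _)).2.1

theorem charInvariant_three : charInvariant L 3 p = -(opMatrix (L p)).det := by
  rw [charInvariant, charpoly_eq_opMatrix]
  exact (coeff_cubic _ _ _ _ (Matrix.charpoly_fin_three _)).2.2

open Polynomial in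
theorem charpoly_eq_charInvariant :
    LinearMap.charpoly (L p : (Fin 3 → ℝ) →ₗ[ℝ] (Fin 3 → ℝ)) =
      X ^ 3 + C (charInvariant L 1 p) * X ^ 2 + C (charInvariant L 2 p) * X
        + C (charInvariant L 3 p) := by
  rw [charInvariant_one, charInvariant_two, charInvariant_three, charpoly_eq_opMatrix]
  exact Matrix.charpoly_fin_three _

theorem cayley_hamilton_opMatrix :
    opMatrix (L p) ^ 3 + charInvariant L 1 p • opMatrix (L p) ^ 2
      + charInvariant L 2 p • opMatrix (L p)
      + charInvariant L 3 p • (1 : Matrix (Fin 3) (Fin 3) ℝ) = 0 := by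
  have h := Matrix.aeval_self_charpoly (opMatrix (L p))
  rw [← charpoly_eq_opMatrix, charpoly_eq_charInvariant] at h
  simpa [Algebra.smul_def] using h

end charInvariant

/-! ### Smoothness of the invariants -/

section Smoothness

variable {L : (Fin 3 → ℝ) → (Fin 3 → ℝ) →L[ℝ] (Fin 3 → ℝ)} {U : Set (Fin 3 → ℝ)}

theorem contDiffOn_opMatrix (hL : ContDiffOn ℝ ∞ L U) (i j : Fin 3) :
    ContDiffOn ℝ ∞ (fun p => opMatrix (L p) i j) U := by
  have h : ContDiffOn ℝ ∞ (fun p => L p (Pi.single j 1)) U := hL.clm_apply contDiffOn_const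
  have h' := contDiffOn_pi.1 h i
  refine h'.congr fun p _ => ?_
  simp [opMatrix, LinearMap.toMatrix'_apply]

theorem contDiffOn_charInvariant_one (hL : ContDiffOn ℝ ∞ L U) :
    ContDiffOn ℝ ∞ (charInvariant L 1) U := by
  have e : charInvariant L 1 = fun p => _ := funext fun p => charInvariant_one L p
  rw [e]
  simp only [Matrix.trace_fin_three]
  have h := contDiffOn_opMatrix hL
  exact (((h 0 0).add (h 1 1)).add (h 2 2)).neg

theorem contDiffOn_charInvariant_two (hL : ContDiffOn ℝ ∞ L U) :
    ContDiffOn ℝ ∞ (charInvariant L 2) U := by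
  have e : charInvariant L 2 = fun p => _ := funext fun p => charInvariant_two L p
  rw [e]
  have h := contDiffOn_opMatrix hL
  exact (((((((h 0 0).mul (h 1 1)).sub ((h 0 1).mul (h 1 0))).add ((h 0 0).mul (h 2 2))).sub
    ((h 0 2).mul (h 2 0))).add ((h 1 1).mul (h 2 2))).sub ((h 1 2).mul (h 2 1)))

theorem contDiffOn_charInvariant_three (hL : ContDiffOn ℝ ∞ L U) :
    ContDiffOn ℝ ∞ (charInvariant L 3) U := by
  have e : charInvariant L 3 = fun p => _ := funext fun p => charInvariant_three L p
  rw [e]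
  simp only [Matrix.det_fin_three]
  have h := contDiffOn_opMatrix hL
  exact (((((((h 0 0).mul (h 1 1)).mul (h 2 2)).sub (((h 0 0).mul (h 1 2)).mul (h 2 1))).sub
    (((h 0 1).mul (h 1 0)).mul (h 2 2))).add (((h 0 1).mul (h 1 2)).mul (h 2 0))).add
    (((h 0 2).mul (h 1 0)).mul (h 2 1))).sub (((h 0 2).mul (h 1 1)).mul (h 2 0)) |>.neg

end Smoothness

/-! ### Vanishing torsion and the differentials of the invariants -/

section Torsion

variable {L : (Fin 3 → ℝ) → (Fin 3 → ℝ) →L[ℝ] (Fin 3 → ℝ)} {U : Set (Fin 3 → ℝ)}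
  {p : Fin 3 → ℝ}

/-- On constant fields `[u, v] = 0` and the other brackets reduce to derivatives of `L`. -/
theorem IsNijenhuisOn.fderiv_identity (hL : IsNijenhuisOn L U) (hU : IsOpen U) (hp : p ∈ U)
    (u v : Fin 3 → ℝ) :
    fderiv ℝ L p (L p u) v - fderiv ℝ L p (L p v) u + L p (fderiv ℝ L p v u)
      - L p (fderiv ℝ L p u v) = 0 := by
  have h := hL.torsion_eq_zero (fun _ => u) (fun _ => v) contDiffOn_const contDiffOn_const p hp
  have hd : DifferentiableAt ℝ L p :=
    (hL.smooth.contDiffAt (hU.mem_nhds hp)).differentiableAt (by simp)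
  have hw (w : Fin 3 → ℝ) : fderiv ℝ (fun q => L q w) p = (fderiv ℝ L p).flip w := by
    have := hd.hasFDerivAt.clm_apply (hasFDerivAt_const w p)
    rw [this.fderiv]
    ext; simp
  simp only [nijenhuisTorsion, VectorField.lieBracket, hw] at h
  simp at h
  rw [← h]

/-- The derivative of `L` at `p` in the direction `u`, as a matrix. -/
noncomputable abbrev opMatrixDeriv (L : (Fin 3 → ℝ) → (Fin 3 → ℝ) →L[ℝ] (Fin 3 → ℝ))
    (p u : Fin 3 → ℝ) : Matrix (Fin 3) (Fin 3) ℝ :=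
  opMatrix (fderiv ℝ L p u)

theorem hasFDerivAt_opMatrix (hd : DifferentiableAt ℝ L p) (i j : Fin 3) :
    HasFDerivAt (fun q => opMatrix (L q) i j)
      ((ContinuousLinearMap.proj i).comp ((fderiv ℝ L p).flip (Pi.single j 1))) p := by
  have h := hd.hasFDerivAt.clm_apply (hasFDerivAt_const (Pi.single j 1 : Fin 3 → ℝ) p)
  have h' := hasFDerivAt_pi'.1 h i
  have e : (fun q => opMatrix (L q) i j) = fun q => L q (Pi.single j 1) i := by
    ext q; simp [opMatrix, LinearMap.toMatrix'_apply]
  rw [e]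
  simpa using h'

theorem opMatrixDeriv_apply (u : Fin 3 → ℝ) (i j : Fin 3) :
    opMatrixDeriv L p u i j =
      ((ContinuousLinearMap.proj i : (Fin 3 → ℝ) →L[ℝ] ℝ).comp
        ((fderiv ℝ L p).flip (Pi.single j 1))) u := by
  simp [LinearMap.toMatrix'_apply]

/-- With `u` fixed, the torsion equation says that `D_{Lu}L - L·D_uL` is a commutator `[B, L]`,
where `Bv = (D_vL)u`. Commutators with `L` are killed by the trace against any power of `L`. -/
theorem IsNijenhuisOn.trace_identity (hL : IsNijenhuisOn L U) (hU : IsOpen U) (hp : p ∈ U)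
    (u : Fin 3 → ℝ) (k : ℕ) :
    (opMatrix (L p) ^ k * opMatrixDeriv L p (L p u)).trace =
      (opMatrix (L p) ^ (k + 1) * opMatrixDeriv L p u).trace := by
  set A := opMatrix (L p)
  set B := opMatrix ((fderiv ℝ L p).flip u)
  have h : opMatrixDeriv L p (L p u) - B * A + A * B - A * opMatrixDeriv L p u = 0 := by
    apply Matrix.toLin'.injective
    ext v : 1
    simp only [A, B, opMatrix, opMatrixDeriv, map_add, map_sub, Matrix.toLin'_mul,
      Matrix.toLin'_toMatrix']
    ext1
    simpa using hL.fderiv_identity hU hp u (Pi.single v 1)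
  have h2 : (A ^ k * (opMatrixDeriv L p (L p u) - B * A + A * B
      - A * opMatrixDeriv L p u)).trace = 0 := by rw [h]; simp
  have h3 : (A ^ k * (B * A)).trace = (A ^ k * (A * B)).trace := by
    rw [← mul_assoc, Matrix.trace_mul_comm, ← mul_assoc, ← mul_assoc, ← pow_succ, ← pow_succ']
  rw [mul_sub, mul_add, mul_sub, Matrix.trace_sub, Matrix.trace_add, Matrix.trace_sub, h3,
    ← mul_assoc _ A (opMatrixDeriv L p u), ← pow_succ] at h2
  linarith

theorem fderiv_charInvariant_one (hd : DifferentiableAt ℝ L p) (u : Fin 3 → ℝ) :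
    fderiv ℝ (charInvariant L 1) p u = -(opMatrixDeriv L p u).trace := by
  have e : charInvariant L 1 = fun p => _ := funext fun p => charInvariant_one L p
  simp only [Matrix.trace_fin_three] at e ⊢
  have h := hasFDerivAt_opMatrix hd
  rw [e]
  refine (congrArg (fun f => f u) (((h 0 0).add (h 1 1)).add (h 2 2)).neg.fderiv).trans ?_
  simp only [neg_apply, add_apply, ← opMatrixDeriv_apply]

theorem fderiv_charInvariant_two (hd : DifferentiableAt ℝ L p) (u : Fin 3 → ℝ) :
    fderiv ℝ (charInvariant L 2) p u =
      -charInvariant L 1 p * (opMatrixDeriv L p u).trace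
        - (opMatrix (L p) * opMatrixDeriv L p u).trace := by
  have e : charInvariant L 2 = fun p => _ := funext fun p => charInvariant_two L p
  rw [charInvariant_one]
  simp only [Matrix.trace_fin_three, Matrix.mul_apply, Fin.sum_univ_three]
  have h := hasFDerivAt_opMatrix hd
  have := (((((((h 0 0).mul (h 1 1)).sub ((h 0 1).mul (h 1 0))).add ((h 0 0).mul (h 2 2))).sub
    ((h 0 2).mul (h 2 0))).add ((h 1 1).mul (h 2 2))).sub ((h 1 2).mul (h 2 1)))
  rw [e]
  refine (congrArg (fun f => f u) this.fderiv).trans ?_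
  simp only [add_apply, sub_apply,
    smul_apply, ← opMatrixDeriv_apply, smul_eq_mul]
  ring

theorem fderiv_charInvariant_three (hd : DifferentiableAt ℝ L p) (u : Fin 3 → ℝ) :
    fderiv ℝ (charInvariant L 3) p u =
      -((opMatrix (L p) ^ 2 * opMatrixDeriv L p u).trace
        + charInvariant L 1 p * (opMatrix (L p) * opMatrixDeriv L p u).trace
        + charInvariant L 2 p * (opMatrixDeriv L p u).trace) := by
  have e : charInvariant L 3 = fun p => _ := funext fun p => charInvariant_three L p
  rw [charInvariant_one, charInvariant_two, pow_two]
  simp only [Matrix.trace_fin_three, Matrix.mul_apply, Fin.sum_univ_three, Matrix.det_fin_three]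
    at e ⊢
  have h := hasFDerivAt_opMatrix hd
  have := (((((((h 0 0).mul (h 1 1)).mul (h 2 2)).sub (((h 0 0).mul (h 1 2)).mul (h 2 1))).sub
    (((h 0 1).mul (h 1 0)).mul (h 2 2))).add (((h 0 1).mul (h 1 2)).mul (h 2 0))).add
    (((h 0 2).mul (h 1 0)).mul (h 2 1))).sub (((h 0 2).mul (h 1 1)).mul (h 2 0)) |>.neg
  rw [e]
  refine (congrArg (fun f => f u) this.fderiv).trans ?_
  simp only [add_apply, sub_apply,
    neg_apply,
    smul_apply, ← opMatrixDeriv_apply, smul_eq_mul, Pi.mul_apply]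
  ring

theorem IsNijenhuisOn.differentiableAt (hL : IsNijenhuisOn L U) (hU : IsOpen U) (hp : p ∈ U) :
    DifferentiableAt ℝ L p :=
  (hL.smooth.contDiffAt (hU.mem_nhds hp)).differentiableAt (by simp)

/-- Together with the next two lemmas, this determines `L^*` on the span of the `dσᵢ`: each `dσᵢ` is
a combination of traces `tr(LᵏdL)`, and `L^*` raises `k` by one. -/
theorem IsNijenhuisOn.fderiv_one_comp (hL : IsNijenhuisOn L U) (hU : IsOpen U) (hp : p ∈ U)
    (u : Fin 3 → ℝ) :
    fderiv ℝ (charInvariant L 1) p (L p u) =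
      fderiv ℝ (charInvariant L 2) p u
        - charInvariant L 1 p * fderiv ℝ (charInvariant L 1) p u := by
  have hd := hL.differentiableAt hU hp
  have h0 := hL.trace_identity hU hp u 0
  simp only [pow_zero, one_mul, zero_add, pow_one] at h0
  rw [fderiv_charInvariant_one hd, fderiv_charInvariant_one hd, fderiv_charInvariant_two hd, h0]
  ring

theorem IsNijenhuisOn.fderiv_two_comp (hL : IsNijenhuisOn L U) (hU : IsOpen U) (hp : p ∈ U)
    (u : Fin 3 → ℝ) :
    fderiv ℝ (charInvariant L 2) p (L p u) =
      fderiv ℝ (charInvariant L 3) p u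
        - charInvariant L 2 p * fderiv ℝ (charInvariant L 1) p u := by
  have hd := hL.differentiableAt hU hp
  have h0 := hL.trace_identity hU hp u 0
  have h1 := hL.trace_identity hU hp u 1
  simp only [pow_zero, one_mul, zero_add, pow_one, Nat.reduceAdd] at h0 h1
  rw [fderiv_charInvariant_one hd, fderiv_charInvariant_two hd, fderiv_charInvariant_three hd,
    h0, h1]
  ring

theorem IsNijenhuisOn.fderiv_three_comp (hL : IsNijenhuisOn L U) (hU : IsOpen U) (hp : p ∈ U)
    (u : Fin 3 → ℝ) :
    fderiv ℝ (charInvariant L 3) p (L p u) =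
      -(charInvariant L 3 p * fderiv ℝ (charInvariant L 1) p u) := by
  have hd := hL.differentiableAt hU hp
  have h0 := hL.trace_identity hU hp u 0
  have h1 := hL.trace_identity hU hp u 1
  have h2 := hL.trace_identity hU hp u 2
  -- Cayley–Hamilton reduces the term `tr(L³dL)` produced by `k = 2`.
  have hc : ((opMatrix (L p) ^ 3 + charInvariant L 1 p • opMatrix (L p) ^ 2
      + charInvariant L 2 p • opMatrix (L p)
      + charInvariant L 3 p • (1 : Matrix (Fin 3) (Fin 3) ℝ)) * opMatrixDeriv L p u).trace = 0 := by
    rw [cayley_hamilton_opMatrix]; simp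
  simp only [pow_zero, one_mul, zero_add, pow_one, Nat.reduceAdd] at h0 h1 h2
  simp only [add_mul, Matrix.smul_mul, one_mul, Matrix.trace_add, Matrix.trace_smul,
    smul_eq_mul] at hc
  rw [fderiv_charInvariant_one hd, fderiv_charInvariant_three hd, h0, h1, h2]
  linarith

end Torsion

/-! ### Inverse function theorem with a smooth inverse -/

section InverseFunction

variable {E : Type*} [NormedAddCommGroup E] [NormedSpace ℝ E] [FiniteDimensional ℝ E]

theorem exists_coordinateChange {F : E → E} {U : Set E} (hU : IsOpen U) (h0 : (0 : E) ∈ U)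
    (hF : ContDiffOn ℝ ∞ F U) (hF0 : F 0 = 0) (hinj : ∀ w, fderiv ℝ F 0 w = 0 → w = 0) :
    ∃ φ : OpenPartialHomeomorph E E, IsCoordinateChange φ U ∧ ⇑φ = F := by
  have : CompleteSpace E := FiniteDimensional.complete ℝ E
  have hFat {p : E} (hp : p ∈ U) : ContDiffAt ℝ ∞ F p := hF.contDiffAt (hU.mem_nhds hp)
  let e : E ≃L[ℝ] E := (LinearEquiv.ofInjectiveEndo (fderiv ℝ F 0 : E →ₗ[ℝ] E)
    ((injective_iff_map_eq_zero _).2 hinj)).toContinuousLinearEquiv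
  have he : (e : E →L[ℝ] E) = fderiv ℝ F 0 := by ext; rfl
  have hd : HasFDerivAt F (e : E →L[ℝ] E) 0 := by
    rw [he]; exact ((hFat h0).differentiableAt (by simp)).hasFDerivAt
  -- Restricting to points with invertible derivative makes the inverse smooth on the whole target,
  -- not only at the image of `0`.
  let V : Set E := U ∩ fderiv ℝ F ⁻¹' Set.range ((↑) : (E ≃L[ℝ] E) → E →L[ℝ] E)
  have hV : IsOpen V :=
    (hF.continuousOn_fderiv_of_isOpen hU (by simp)).isOpen_inter_preimage hU
      ContinuousLinearEquiv.isOpen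
  let φ₀ := (hFat h0).toOpenPartialHomeomorph F hd (by simp)
  let φ := φ₀.restrOpen V hV
  have hsub : φ.source ⊆ V := fun p hp => hp.2
  refine ⟨φ, ⟨⟨(hFat h0).mem_toOpenPartialHomeomorph_source hd (by simp), h0, e, he⟩,
    fun p hp => (hsub hp).1, hF0, hF.mono fun p hp => (hsub hp).1, ?_⟩, rfl⟩
  intro q hq
  obtain ⟨hmem, e', he'⟩ := hsub (φ.map_target hq)
  refine (φ.contDiffAt_symm (f₀' := e') hq ?_ (hFat hmem)).contDiffWithinAt
  rw [he']
  exact ((hFat hmem).differentiableAt (by simp)).hasFDerivAt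

end InverseFunction

/-! ### Cross products and tangents to level lines -/

section CrossProduct

/-- By the triple product expansion `w × (a × b) = 0`, so the two vectors are parallel. The
componentwise form can be differentiated along a curve without a proportionality factor. -/
theorem cross_smul_eq_of_dotProduct_eq_zero {a b w : Fin 3 → ℝ}
    (ha : a ⬝ᵥ w = 0) (hb : b ⬝ᵥ w = 0) (i : Fin 3) : (a ⨯₃ b) i • w = w i • a ⨯₃ b := by
  have h : w ⨯₃ (a ⨯₃ b) = 0 := by
    rw [cross_cross_eq_smul_sub_smul', dotProduct_comm w b, hb, ha]
    simp
  have h0 := congrFun h 0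
  have h1 := congrFun h 1
  have h2 := congrFun h 2
  generalize a ⨯₃ b = c at *
  simp [cross_apply] at h0 h1 h2
  ext j
  fin_cases i <;> fin_cases j <;> simp <;> linarith

/-- The vector of partial derivatives of a function on `ℝ³`. -/
noncomputable def grad (f : (Fin 3 → ℝ) → ℝ) (p : Fin 3 → ℝ) : Fin 3 → ℝ :=
  fun i => fderiv ℝ f p (Pi.single i 1)

theorem dotProduct_grad (f : (Fin 3 → ℝ) → ℝ) (p w : Fin 3 → ℝ) :
    grad f p ⬝ᵥ w = fderiv ℝ f p w := by
  conv_rhs => rw [← Finset.univ_sum_single w, map_sum]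
  refine Finset.sum_congr rfl fun i _ => ?_
  have : (Pi.single i (w i) : Fin 3 → ℝ) = w i • Pi.single i 1 := by
    rw [← Pi.single_smul]; simp
  rw [this, map_smul, grad, smul_eq_mul, mul_comm]

theorem ContDiffOn.grad {f : (Fin 3 → ℝ) → ℝ} {U : Set (Fin 3 → ℝ)} (hf : ContDiffOn ℝ ∞ f U)
    (hU : IsOpen U) : ContDiffOn ℝ ∞ (grad f) U :=
  contDiffOn_pi.2 fun _ => (hf.fderiv_of_isOpen hU (by simp)).clm_apply contDiffOn_const

/-- The vector field `∇f × ∇g`, tangent to the joint level lines of `f` and `g`. -/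
noncomputable def crossGrad (f g : (Fin 3 → ℝ) → ℝ) (p : Fin 3 → ℝ) : Fin 3 → ℝ :=
  grad f p ⨯₃ grad g p

variable {f g : (Fin 3 → ℝ) → ℝ} {U : Set (Fin 3 → ℝ)} {p : Fin 3 → ℝ}

theorem fderiv_left_crossGrad (f g : (Fin 3 → ℝ) → ℝ) (p : Fin 3 → ℝ) :
    fderiv ℝ f p (crossGrad f g p) = 0 := by
  rw [← dotProduct_grad, crossGrad, dot_self_cross]

theorem fderiv_right_crossGrad (f g : (Fin 3 → ℝ) → ℝ) (p : Fin 3 → ℝ) :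
    fderiv ℝ g p (crossGrad f g p) = 0 := by
  rw [← dotProduct_grad, crossGrad, dot_cross_self]

theorem ContDiffOn.crossGrad (hf : ContDiffOn ℝ ∞ f U) (hg : ContDiffOn ℝ ∞ g U)
    (hU : IsOpen U) : ContDiffOn ℝ ∞ (crossGrad f g) U := by
  have hf' := contDiffOn_pi.1 (hf.grad hU)
  have hg' := contDiffOn_pi.1 (hg.grad hU)
  refine contDiffOn_pi.2 fun i => ?_
  simp only [_root_.crossGrad, cross_apply]
  fin_cases i
  · exact ((hf' 1).mul (hg' 2)).sub ((hf' 2).mul (hg' 1))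
  · exact ((hf' 2).mul (hg' 0)).sub ((hf' 0).mul (hg' 2))
  · exact ((hf' 0).mul (hg' 1)).sub ((hf' 1).mul (hg' 0))

theorem crossGrad_ne_zero (h : LinearIndependent ℝ ![fderiv ℝ f p, fderiv ℝ g p]) :
    crossGrad f g p ≠ 0 := by
  rw [crossGrad, crossProduct_ne_zero_iff_linearIndependent]
  rw [LinearIndependent.pair_iff] at h ⊢
  intro s t hst
  refine h s t (ContinuousLinearMap.ext fun w => ?_)
  have := congrArg (· ⬝ᵥ w) hst
  simpa [add_dotProduct, smul_dotProduct, dotProduct_grad] using this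

theorem crossGrad_smul_eq {w : Fin 3 → ℝ} (hf : fderiv ℝ f p w = 0) (hg : fderiv ℝ g p w = 0)
    (i : Fin 3) : crossGrad f g p i • w = w i • crossGrad f g p :=
  cross_smul_eq_of_dotProduct_eq_zero (by rwa [dotProduct_grad]) (by rwa [dotProduct_grad]) i

theorem exists_smul_crossGrad (h : crossGrad f g p ≠ 0) {w : Fin 3 → ℝ}
    (hf : fderiv ℝ f p w = 0) (hg : fderiv ℝ g p w = 0) : ∃ τ : ℝ, w = τ • crossGrad f g p := by
  obtain ⟨i, hi⟩ := Function.ne_iff.1 h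
  refine ⟨(crossGrad f g p i)⁻¹ * w i, ?_⟩
  rw [mul_smul, ← crossGrad_smul_eq hf hg, inv_smul_smul₀ hi]

theorem fderiv_vec3 {F₀ F₁ F₂ : (Fin 3 → ℝ) → ℝ} (h₀ : DifferentiableAt ℝ F₀ p)
    (h₁ : DifferentiableAt ℝ F₁ p) (h₂ : DifferentiableAt ℝ F₂ p) (w : Fin 3 → ℝ) :
    fderiv ℝ (fun q => ![F₀ q, F₁ q, F₂ q]) p w =
      ![fderiv ℝ F₀ p w, fderiv ℝ F₁ p w, fderiv ℝ F₂ p w] := by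
  have hd : DifferentiableAt ℝ (fun q => ![F₀ q, F₁ q, F₂ q]) p :=
    differentiableAt_pi.2 fun i => by fin_cases i <;> assumption
  have := hasFDerivAt_pi'.1 hd.hasFDerivAt
  ext i
  fin_cases i
  · exact congrArg (fun T => T w) (this 0).fderiv.symm
  · exact congrArg (fun T => T w) (this 1).fderiv.symm
  · exact congrArg (fun T => T w) (this 2).fderiv.symm

/-- Functions `f`, `k`, `g` vanishing at `0` are local coordinates as soon as `k` has nonzero
derivative along the level line of `f` and `g`. -/
theorem exists_coordinateChange_vec3 {k : (Fin 3 → ℝ) → ℝ} (hU : IsOpen U)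
    (h0 : (0 : Fin 3 → ℝ) ∈ U) (hf : ContDiffOn ℝ ∞ f U) (hk : ContDiffOn ℝ ∞ k U)
    (hg : ContDiffOn ℝ ∞ g U) (hf0 : f 0 = 0) (hk0 : k 0 = 0) (hg0 : g 0 = 0)
    (hX : crossGrad f g 0 ≠ 0) (hkX : fderiv ℝ k 0 (crossGrad f g 0) ≠ 0) :
    ∃ φ : OpenPartialHomeomorph (Fin 3 → ℝ) (Fin 3 → ℝ), IsCoordinateChange φ U ∧
      ⇑φ = fun p => ![f p, k p, g p] := by
  have hd {F : (Fin 3 → ℝ) → ℝ} (hF : ContDiffOn ℝ ∞ F U) : DifferentiableAt ℝ F 0 :=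
    (hF.contDiffAt (hU.mem_nhds h0)).differentiableAt (by simp)
  refine exists_coordinateChange hU h0
    (contDiffOn_pi.2 fun i => by fin_cases i <;> assumption) (by simp [hf0, hk0, hg0])
    fun w hw => ?_
  rw [fderiv_vec3 (hd hf) (hd hk) (hd hg)] at hw
  obtain ⟨τ, rfl⟩ := exists_smul_crossGrad hX (congrFun hw 0) (congrFun hw 2)
  have h1 := congrFun hw 1
  simp only [map_smul] at h1
  have : τ = 0 := by simpa [hkX] using h1
  simp [this]

end CrossProduct

/-! ### Taylor remainder in the middle variable -/

section MorseRemainder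

/-- Multiply the middle coordinate by `t`. -/
def scaleMiddle (t : ℝ) (q : Fin 3 → ℝ) : Fin 3 → ℝ := ![q 0, t * q 1, q 2]

theorem scaleMiddle_one (q : Fin 3 → ℝ) : scaleMiddle 1 q = q := by
  ext i; fin_cases i <;> simp [scaleMiddle]

theorem scaleMiddle_of_middle_eq_zero (t : ℝ) {q : Fin 3 → ℝ} (hq : q 1 = 0) :
    scaleMiddle t q = q := by
  ext i; fin_cases i <;> simp [scaleMiddle, hq]

theorem contDiff_scaleMiddle :
    ContDiff ℝ ∞ (fun x : (Fin 3 → ℝ) × ℝ => scaleMiddle x.2 x.1) := by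
  refine contDiff_pi.2 fun i => ?_
  fin_cases i <;> simp [scaleMiddle] <;> fun_prop

theorem norm_scaleMiddle_le {t : ℝ} {C : ℝ} (hC : 1 ≤ C) (ht : |t| ≤ C) (q : Fin 3 → ℝ) :
    ‖scaleMiddle t q‖ ≤ C * ‖q‖ := by
  have hq := norm_nonneg q
  refine (pi_norm_le_iff_of_nonneg (by positivity)).2 fun i => ?_
  have h1 : ‖q i‖ ≤ C * ‖q‖ := (norm_le_pi_norm q i).trans (by nlinarith)
  fin_cases i
  · simpa [scaleMiddle] using h1
  · simp only [scaleMiddle, Fin.mk_one, Matrix.cons_val_one, Matrix.cons_val_zero, norm_mul]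
    exact mul_le_mul ht (norm_le_pi_norm q 1) (norm_nonneg _) (by linarith)
  · simpa [scaleMiddle] using h1

theorem norm_scaleMiddle_le_self {t : ℝ} (ht : |t| ≤ 1) (q : Fin 3 → ℝ) :
    ‖scaleMiddle t q‖ ≤ ‖q‖ := by
  simpa using norm_scaleMiddle_le le_rfl ht q

/-- The integral `∫₀¹ t m(x, t y, z) dt`, for `q = (x, y, z)`. -/
noncomputable def morseRemainder (m : (Fin 3 → ℝ) → ℝ) (q : Fin 3 → ℝ) : ℝ :=
  ∫ t in (0 : ℝ)..1, t * m (scaleMiddle t q)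

open MeasureTheory in
-- The integral is a convolution, evaluated at `0`, of the indicator of `(0, 1]` with a compactly
-- supported kernel depending on `q`; this explains the sign `-s`. The cutoff equals `1` on `[-1,
-- 1]` and vanishes for `|s| ≥ 2`. Since the middle coordinate may be doubled on its support, the
-- radius is halved.
theorem contDiffOn_morseRemainder {m : (Fin 3 → ℝ) → ℝ} {r : ℝ}
    (hm : ContDiffOn ℝ ∞ m (Metric.ball 0 r)) :
    ContDiffOn ℝ ∞ (morseRemainder m) (Metric.ball 0 (r / 2)) := by
  let b : ContDiffBump (0 : ℝ) := ⟨1, 2, by norm_num, by norm_num⟩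
  let g : (Fin 3 → ℝ) → ℝ → ℝ := fun q s => b s * (-s * m (scaleMiddle (-s) q))
  have hg : ContDiffOn ℝ ∞ ↿g (Metric.ball 0 (r / 2) ×ˢ Set.univ) := by
    rintro ⟨q, s⟩ ⟨hq, -⟩
    rw [mem_ball_zero_iff] at hq
    by_cases hs : s ∈ Metric.closedBall (0 : ℝ) 2
    · have hmem : scaleMiddle (-s) q ∈ Metric.ball (0 : Fin 3 → ℝ) r := by
        rw [mem_ball_zero_iff]
        have := norm_scaleMiddle_le (C := 2) (t := -s) (by norm_num) (by simpa using hs) q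
        linarith
      have h1 : ContDiffAt ℝ ∞ (fun x : (Fin 3 → ℝ) × ℝ => m (scaleMiddle (-x.2) x.1)) (q, s) := by
        have h2 : ContDiffAt ℝ ∞ (fun x : (Fin 3 → ℝ) × ℝ => scaleMiddle (-x.2) x.1) (q, s) :=
          (contDiff_scaleMiddle.comp (contDiff_fst.prodMk contDiff_snd.neg)).contDiffAt
        exact (hm.contDiffAt (Metric.isOpen_ball.mem_nhds hmem)).comp
          (q, s) h2
      have h3 : ContDiffAt ℝ ∞ (fun x : (Fin 3 → ℝ) × ℝ => b x.2) (q, s) :=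
        (b.contDiff.comp contDiff_snd).contDiffAt
      exact (h3.mul (contDiff_snd.neg.contDiffAt.mul h1)).contDiffWithinAt
    · have hopen : IsOpen {x : (Fin 3 → ℝ) × ℝ | x.2 ∈ (Metric.closedBall (0 : ℝ) 2)ᶜ} :=
        Metric.isClosed_closedBall.isOpen_compl.preimage continuous_snd
      have : ↿g =ᶠ[𝓝 (q, s)] fun _ => 0 := by
        filter_upwards [hopen.mem_nhds hs] with x hx
        have : b x.2 = 0 := b.zero_of_le_dist (by
          have : x.2 ∉ Metric.closedBall (0 : ℝ) 2 := hx
          rw [Metric.mem_closedBall, not_le] at this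
          exact this.le)
        simp [g, Function.HasUncurry.uncurry, this]
      exact (contDiffAt_const.congr_of_eventuallyEq this).contDiffWithinAt
  have hf : LocallyIntegrable (Set.indicator (Set.Ioc (0 : ℝ) 1) fun _ => (1 : ℝ)) volume :=
    ((integrableOn_const (by simp)).integrable_indicator measurableSet_Ioc).locallyIntegrable
  have := contDiffOn_convolution_right_with_param_comp (n := ⊤) (μ := volume)
    (ContinuousLinearMap.mul ℝ ℝ)
    (contDiffOn_const (c := (0 : ℝ))) Metric.isOpen_ball (isCompact_closedBall (0 : ℝ) 2)
    (fun q s _ hs => by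
      have : b s = 0 := b.zero_of_le_dist (by
          rw [Metric.mem_closedBall, not_le] at hs
          exact hs.le)
      simp [g, this]) hf hg
  refine this.congr fun q _ => ?_
  rw [morseRemainder, intervalIntegral.integral_of_le zero_le_one, convolution_def,
    ← integral_indicator measurableSet_Ioc]
  refine integral_congr_ae (Filter.Eventually.of_forall fun t => ?_)
  by_cases ht : t ∈ Set.Ioc (0 : ℝ) 1
  · have hb : b (-t) = 1 := b.one_of_mem_closedBall (by
      rw [mem_closedBall_zero_iff, norm_neg, Real.norm_eq_abs, abs_le]
      constructor <;> linarith [ht.1, ht.2])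
    simp [ht, g, hb]
  · simp [ht]

theorem morseRemainder_zero (m : (Fin 3 → ℝ) → ℝ) : morseRemainder m 0 = m 0 / 2 := by
  have (t : ℝ) : scaleMiddle t 0 = 0 := scaleMiddle_of_middle_eq_zero t rfl
  simp only [morseRemainder, this]
  rw [intervalIntegral.integral_mul_const, integral_id]
  ring

/-- A function whose derivative in the middle variable is `y m(x, y, z)` differs from its
restriction to `y = 0` by `y ^ 2` times a smooth function. -/
theorem eq_add_sq_mul_morseRemainder {H m : (Fin 3 → ℝ) → ℝ} {r : ℝ}
    (hH : DifferentiableOn ℝ H (Metric.ball 0 r)) (hm : ContinuousOn m (Metric.ball 0 r))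
    (hHm : ∀ q ∈ Metric.ball 0 r, fderiv ℝ H q (Pi.single 1 1) = q 1 * m q)
    {q : Fin 3 → ℝ} (hq : q ∈ Metric.ball 0 r) :
    H q = H (scaleMiddle 0 q) + q 1 ^ 2 * morseRemainder m q := by
  have hmem {t : ℝ} (ht : t ∈ Set.uIcc (0 : ℝ) 1) :
      scaleMiddle t q ∈ Metric.ball (0 : Fin 3 → ℝ) r := by
    rw [Set.uIcc_of_le zero_le_one] at ht
    rw [mem_ball_zero_iff] at hq ⊢
    exact (norm_scaleMiddle_le_self (abs_le.2 ⟨by linarith [ht.1], ht.2⟩) q).trans_lt hq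
  have hs (t : ℝ) : HasDerivAt (fun t => scaleMiddle t q) (q 1 • Pi.single 1 1) t := by
    refine hasDerivAt_pi.2 fun i => ?_
    fin_cases i
    · simpa [scaleMiddle] using hasDerivAt_const t (q 0)
    · simpa [scaleMiddle] using (hasDerivAt_id t).mul_const (q 1)
    · simpa [scaleMiddle] using hasDerivAt_const t (q 2)
  have hderiv : ∀ t ∈ Set.uIcc (0 : ℝ) 1,
      HasDerivAt (fun t => H (scaleMiddle t q)) (q 1 ^ 2 * (t * m (scaleMiddle t q))) t := by
    intro t ht
    have h1 := (hH.differentiableAt (Metric.isOpen_ball.mem_nhds (hmem ht))).hasFDerivAt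
    have h2 := h1.comp_hasDerivAt t (hs t)
    rw [map_smul, hHm _ (hmem ht)] at h2
    refine h2.congr_deriv ?_
    simp [scaleMiddle]; ring
  have hcont : ContinuousOn (fun t => q 1 ^ 2 * (t * m (scaleMiddle t q))) (Set.uIcc (0 : ℝ) 1) :=
    continuousOn_const.mul (continuousOn_id.mul
      (hm.comp (fun t _ => (hs t).continuousAt.continuousWithinAt) fun t ht => hmem ht))
  have := intervalIntegral.integral_eq_sub_of_hasDerivAt hderiv hcont.intervalIntegrable
  rw [intervalIntegral.integral_const_mul, scaleMiddle_one] at this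
  rw [morseRemainder, this]
  ring

end MorseRemainder

/-! ### The Morse condition in terms of `∇f × ∇g` -/

section Morse

/-- The derivative of `k` along the vector field `∇f × ∇g`. -/
noncomputable def jacobian (f k g : (Fin 3 → ℝ) → ℝ) (p : Fin 3 → ℝ) : ℝ :=
  fderiv ℝ k p (crossGrad f g p)

variable {f k g : (Fin 3 → ℝ) → ℝ} {U : Set (Fin 3 → ℝ)}

theorem ContDiffOn.jacobian (hU : IsOpen U) (hf : ContDiffOn ℝ ∞ f U) (hk : ContDiffOn ℝ ∞ k U)
    (hg : ContDiffOn ℝ ∞ g U) : ContDiffOn ℝ ∞ (jacobian f k g) U :=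
  (hk.fderiv_of_isOpen hU (by simp)).clm_apply (hf.crossGrad hg hU)

/-- A Morse singularity on the joint zero line of `f` and `g`, in terms of the vector field
`∇f × ∇g`. -/
theorem HasMorseSingularityOnCurve.jacobian {S : Set (Fin 3 → ℝ)}
    (h : HasMorseSingularityOnCurve k S 0) (hU : IsOpen U) (h0 : (0 : Fin 3 → ℝ) ∈ U)
    (hf : ContDiffOn ℝ ∞ f U) (hk : ContDiffOn ℝ ∞ k U) (hg : ContDiffOn ℝ ∞ g U)
    (hSf : ∀ p ∈ S, f p = 0) (hSg : ∀ p ∈ S, g p = 0) (hX : crossGrad f g 0 ≠ 0) :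
    jacobian f k g 0 = 0 ∧ fderiv ℝ (jacobian f k g) 0 (crossGrad f g 0) ≠ 0 := by
  obtain ⟨γ, hγ, hγ0, hγ', hS, hk1, hk2⟩ := h
  have hUγ : ∀ᶠ s in 𝓝 (0 : ℝ), γ s ∈ U :=
    hγ.continuousAt.eventually_mem (by rw [hγ0]; exact hU.mem_nhds h0)
  have hdγ : ∀ᶠ s in 𝓝 (0 : ℝ), DifferentiableAt ℝ γ s :=
    ((hγ.of_le (m := 1) (by exact_mod_cast le_top)).eventually (by simp)).mono
      fun s hs => hs.differentiableAt (by simp)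
  have hcomp {F : (Fin 3 → ℝ) → ℝ} (hF : ContDiffOn ℝ ∞ F U) {s : ℝ} (hs : γ s ∈ U)
      (hds : DifferentiableAt ℝ γ s) :
      HasDerivAt (fun t => F (γ t)) (fderiv ℝ F (γ s) (deriv γ s)) s :=
    (((hF.contDiffAt (hU.mem_nhds hs)).differentiableAt (by simp)).hasFDerivAt).comp_hasDerivAt
      s hds.hasDerivAt
  have hzero {F : (Fin 3 → ℝ) → ℝ} (hF : ContDiffOn ℝ ∞ F U) (hSF : ∀ p ∈ S, F p = 0) :
      ∀ᶠ s in 𝓝 (0 : ℝ), fderiv ℝ F (γ s) (deriv γ s) = 0 := by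
    filter_upwards [hUγ, hdγ, hS.eventually_nhds] with s hs hds hSs
    refine (hcomp hF hs hds).unique ((hasDerivAt_const s (0 : ℝ)).congr_of_eventuallyEq ?_)
    filter_upwards [hSs] with t ht using hSF _ ht
  have hf0 := hzero hf hSf
  have hg0 := hzero hg hSg
  have hd0 := hdγ.self_of_nhds
  have hJ := ContDiffOn.jacobian hU hf hk hg
  have hU0 : γ 0 ∈ U := hγ0 ▸ h0
  obtain ⟨τ, hτ⟩ := exists_smul_crossGrad (f := f) (g := g) (p := γ 0) (by rwa [hγ0])
    hf0.self_of_nhds hg0.self_of_nhds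
  rw [hγ0] at hτ
  have hτ0 : τ ≠ 0 := by
    rintro rfl
    exact hγ' (by simpa using hτ)
  have hJ0 : _root_.jacobian f k g 0 = 0 := by
    rw [(hcomp hk hU0 hd0).deriv, hτ, hγ0, map_smul, smul_eq_mul] at hk1
    exact (mul_eq_zero.1 hk1).resolve_left hτ0
  refine ⟨hJ0, fun hzero => ?_⟩
  obtain ⟨i, hi⟩ := Function.ne_iff.1 hX
  have hXi : ContDiffOn ℝ ∞ (fun p => crossGrad f g p i) U :=
    contDiffOn_pi.1 (hf.crossGrad hg hU) i
  have hkγ : ContDiffAt ℝ ∞ (fun s => k (γ s)) 0 :=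
    (hk.contDiffAt (hU.mem_nhds hU0)).comp 0 hγ
  have hkd : DifferentiableAt ℝ (deriv fun s => k (γ s)) 0 :=
    (hkγ.derivWithin (m := ∞) (by simp)).differentiableAt (by simp)
  have hγi : DifferentiableAt ℝ (fun s => deriv γ s i) 0 :=
    differentiableAt_pi.1
      ((hγ.derivWithin (m := ∞) (by simp)).differentiableAt (by simp)) i
  have hl := (hcomp hXi hU0 hd0).mul hkd.hasDerivAt
  have hr := hγi.hasDerivAt.mul (hcomp hJ hU0 hd0)
  -- Both `γ'` and `∇f × ∇g` are tangent to the level line, hence parallel. Differentiating this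
  -- equality at `0` leaves a nonzero multiple of `(k ∘ γ)''(0)` on the left, and zero on the right
  -- if `dJ(∇f × ∇g)` vanished.
  have heq : (fun s => crossGrad f g (γ s) i * deriv (fun s => k (γ s)) s) =ᶠ[𝓝 0]
      fun s => deriv γ s i * _root_.jacobian f k g (γ s) := by
    filter_upwards [hUγ, hdγ, hf0, hg0] with s hs hds hfs hgs
    rw [(hcomp hk hs hds).deriv, _root_.jacobian, ← smul_eq_mul, ← smul_eq_mul, ← map_smul,
      ← map_smul, crossGrad_smul_eq hfs hgs]
  have := hl.unique (hr.congr_of_eventuallyEq heq)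
  rw [hτ, hγ0, map_smul (fderiv ℝ (_root_.jacobian f k g) 0), hzero, hJ0, hk1] at this
  simp only [mul_zero, zero_add, smul_zero, add_zero, mul_eq_zero] at this
  exact this.elim hi hk2

end Morse

/-! ### Rigidity of the middle invariant on the critical surface -/

section Rigidity

/-- On a critical point of the middle invariant along the level line of the two others, its
differential is determined by a root of the characteristic polynomial. -/
theorem critical_relations {E : Type*} [NormedAddCommGroup E] [NormedSpace ℝ E]
    {α κ β : E →L[ℝ] ℝ} {A : E → E} {s₁ s₂ s₃ a b : ℝ}
    (hind : LinearIndependent ℝ ![α, β]) (hα : ∀ v, α (A v) = κ v - s₁ * α v)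
    (hκ : ∀ v, κ (A v) = β v - s₂ * α v) (hβ : ∀ v, β (A v) = -(s₃ * α v))
    (hab : ∀ v, κ v = a * α v + b * β v) :
    a * b = 1 ∧ a ^ 2 - a * s₁ - b * s₃ = -s₂ := by
  -- Precompose `κ = aα + bβ` with `A` and compare the coefficients of `α` and `β`.
  have h := LinearIndependent.pair_iff.1 hind (a ^ 2 - a * s₁ - b * s₃ + s₂) (a * b - 1) (by
    ext v
    have h1 := hab (A v)
    rw [hα, hκ, hβ, hab] at h1
    simp only [add_apply, smul_apply, smul_eq_mul, zero_apply]
    linarith)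
  constructor <;> linarith [h.1, h.2]

/-- Let `a`, `b` be the partial derivatives in `x`, `z`. Differentiating both relations along a ray
in the plane `y = 0` gives `b' = -a'b²` and `a'(2a - x + b²z) = 0`. The bracket is nonzero near `0`,
so `a` is constant and the second relation yields `H`. -/
theorem middle_plane_rigidity {H : (Fin 3 → ℝ) → ℝ} {r : ℝ} (hr : 0 < r)
    (hH : ContDiffOn ℝ ∞ H (Metric.ball 0 r))
    (hmul : ∀ q ∈ Metric.ball 0 r, q 1 = 0 → grad H q 0 * grad H q 2 = 1)
    (hval : ∀ q ∈ Metric.ball 0 r, q 1 = 0 →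
      grad H q 0 ^ 2 - grad H q 0 * q 0 - grad H q 2 * q 2 = -H q) :
    ∃ r' > 0, r' ≤ r ∧ ∀ q ∈ Metric.ball 0 r', q 1 = 0 →
      H q = -grad H 0 0 ^ 2 + grad H 0 0 * q 0 + q 2 / grad H 0 0 := by
  have h0r : (0 : Fin 3 → ℝ) ∈ Metric.ball 0 r := Metric.mem_ball_self hr
  have hgrad (i : Fin 3) : ContDiffOn ℝ ∞ (fun q => grad H q i) (Metric.ball 0 r) :=
    contDiffOn_pi.1 (hH.grad Metric.isOpen_ball) i
  have hcont : ContinuousAt (fun q => 2 * grad H q 0 - q 0 + grad H q 2 ^ 2 * q 2) 0 := by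
    have h (i : Fin 3) := ((hgrad i).contDiffAt (Metric.isOpen_ball.mem_nhds h0r)).continuousAt
    exact ((continuousAt_const.mul (h 0)).sub (continuous_apply 0).continuousAt).add
      (((h 2).pow 2).mul (continuous_apply 2).continuousAt)
  have hc0 : grad H 0 0 ≠ 0 := left_ne_zero_of_mul_eq_one (hmul 0 h0r rfl)
  -- The value at `0` is `2a(0) ≠ 0`; this excludes the singular (envelope) solution.
  have hne := hcont.eventually_ne (y := 0) (by simpa using hc0)
  obtain ⟨δ, hδ, hball⟩ := Metric.eventually_nhds_iff_ball.1 hne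
  refine ⟨min δ r, lt_min hδ hr, min_le_right _ _, fun q hq hq1 => ?_⟩
  have hmem {t : ℝ} (ht : t ∈ Set.Icc (0 : ℝ) 1) :
      t • q ∈ Metric.ball (0 : Fin 3 → ℝ) (min δ r) := by
    rw [mem_ball_zero_iff] at hq ⊢
    rw [norm_smul, Real.norm_of_nonneg ht.1]
    nlinarith [norm_nonneg q, ht.2]
  have hmemr {t : ℝ} (ht : t ∈ Set.Icc (0 : ℝ) 1) : t • q ∈ Metric.ball (0 : Fin 3 → ℝ) r :=
    Metric.ball_subset_ball (min_le_right _ _) (hmem ht)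
  have hline (t : ℝ) : HasDerivAt (fun t : ℝ => t • q) q t := by
    simpa using (hasDerivAt_id t).smul_const q
  have hderiv {F : (Fin 3 → ℝ) → ℝ} (hF : ContDiffOn ℝ ∞ F (Metric.ball 0 r)) {t : ℝ}
      (ht : t ∈ Set.Icc (0 : ℝ) 1) :
      HasDerivAt (fun t : ℝ => F (t • q)) (fderiv ℝ F (t • q) q) t :=
    (((hF.contDiffAt (Metric.isOpen_ball.mem_nhds (hmemr ht))).differentiableAt
      (by simp)).hasFDerivAt).comp_hasDerivAt t (hline t)
  have hnear {t : ℝ} (ht : t ∈ Set.Icc (0 : ℝ) 1) :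
      ∀ᶠ s in 𝓝 t, s • q ∈ Metric.ball (0 : Fin 3 → ℝ) r :=
    (hline t).continuousAt.eventually_mem (Metric.isOpen_ball.mem_nhds (hmemr ht))
  have hzero : ∀ t ∈ Set.Icc (0 : ℝ) 1, HasDerivAt (fun t : ℝ => grad H (t • q) 0) 0 t := by
    intro t ht
    have ha := hderiv (hgrad 0) ht
    have hb := hderiv (hgrad 2) ht
    have hh := hderiv hH ht
    have hq0 : HasDerivAt (fun t : ℝ => (t • q) 0) (q 0) t := hasDerivAt_pi.1 (hline t) 0
    have hq2 : HasDerivAt (fun t : ℝ => (t • q) 2) (q 2) t := hasDerivAt_pi.1 (hline t) 2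
    have h1 := (ha.mul hb).unique ((hasDerivAt_const t (1 : ℝ)).congr_of_eventuallyEq (by
      filter_upwards [hnear ht] with s hs using hmul _ hs (by simp [hq1])))
    have h2 := (((ha.pow 2).sub (ha.mul hq0)).sub (hb.mul hq2)).unique
      (hh.neg.congr_of_eventuallyEq (by
        filter_upwards [hnear ht] with s hs using hval _ hs (by simp [hq1])))
    have h3 : fderiv ℝ H (t • q) q = grad H (t • q) 0 * q 0 + grad H (t • q) 2 * q 2 := by
      rw [← dotProduct_grad, dotProduct, Fin.sum_univ_three, hq1]; ring
    have h4 := hmul _ (hmemr ht) (by simp [hq1])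
    have h5 := hball _ (Metric.ball_subset_ball (min_le_left _ _) (hmem ht))
    rw [h3] at h2
    simp only [Nat.cast_ofNat, Nat.add_one_sub_one, pow_one] at h1 h2
    generalize fderiv ℝ (fun q => grad H q 0) (t • q) q = a' at *
    generalize fderiv ℝ (fun q => grad H q 2) (t • q) q = b' at *
    have hb' : b' = -(a' * grad H (t • q) 2 ^ 2) := by
      linear_combination grad H (t • q) 2 * h1 - b' * h4
    have : a' * (2 * grad H (t • q) 0 - (t • q) 0 + grad H (t • q) 2 ^ 2 * (t • q) 2) = 0 := by
      rw [hb'] at h2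
      linear_combination h2
    rwa [(mul_eq_zero.1 this).resolve_right h5] at ha
  have hconst := constant_of_has_deriv_right_zero
    (fun t ht => (hzero t ht).continuousAt.continuousWithinAt)
    (fun t ht => (hzero t (Set.Ico_subset_Icc_self ht)).hasDerivWithinAt) 1 (by simp)
  have hqr := Metric.ball_subset_ball (min_le_right _ _) hq
  have h1 := hval q hqr hq1
  have h2 := hmul q hqr hq1
  simp only [one_smul, zero_smul] at hconst
  rw [hconst] at h1 h2
  rw [div_eq_mul_inv, ← eq_inv_of_mul_eq_one_right h2]
  linarith

end Rigidity

/-! ### Adapted coordinates for the invariants -/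

section NormalForm

variable {L : (Fin 3 → ℝ) → (Fin 3 → ℝ) →L[ℝ] (Fin 3 → ℝ)} {U : Set (Fin 3 → ℝ)}

/-- Coordinates in which the invariants of the Nijenhuis operator have the required form. -/
theorem IsNijenhuisOn.exists_coordinates (hL : IsNijenhuisOn L U) (hU : IsOpen U)
    (h0 : (0 : Fin 3 → ℝ) ∈ U)
    (hind : ∀ᶠ p in 𝓝 (0 : Fin 3 → ℝ),
      LinearIndependent ℝ ![fderiv ℝ (charInvariant L 1) p, fderiv ℝ (charInvariant L 3) p])
    (h1 : charInvariant L 1 0 = 0) (h3 : charInvariant L 3 0 = 0)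
    (hMorse : HasMorseSingularityOnCurve (charInvariant L 2)
      {p | p ∈ U ∧ charInvariant L 1 p = 0 ∧ charInvariant L 3 p = 0} 0) :
    ∃ c ε : ℝ, c ≠ 0 ∧ charInvariant L 2 0 = -c ^ 2 ∧ (ε = 1 ∨ ε = -1) ∧
      ∃ (y : (Fin 3 → ℝ) → ℝ) (φ : OpenPartialHomeomorph (Fin 3 → ℝ) (Fin 3 → ℝ)),
        IsCoordinateChange φ U ∧
        (⇑φ = fun p => ![charInvariant L 1 p, y p, charInvariant L 3 p]) ∧
        ContDiffOn ℝ ∞ y φ.source ∧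
        ∀ p ∈ φ.source, charInvariant L 2 p =
          ε * y p ^ 2 + c * charInvariant L 1 p + charInvariant L 3 p / c - c ^ 2 := by
  set f := charInvariant L 1 with hf_def
  set k := charInvariant L 2 with hk_def
  set g := charInvariant L 3 with hg_def
  have hf : ContDiffOn ℝ ∞ f U := contDiffOn_charInvariant_one hL.smooth
  have hk : ContDiffOn ℝ ∞ k U := contDiffOn_charInvariant_two hL.smooth
  have hg : ContDiffOn ℝ ∞ g U := contDiffOn_charInvariant_three hL.smooth
  have hX0 : crossGrad f g 0 ≠ 0 := crossGrad_ne_zero hind.self_of_nhds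
  obtain ⟨hJ0, hJX0⟩ := hMorse.jacobian hU h0 hf hk hg (fun p hp => hp.2.1)
    (fun p hp => hp.2.2) hX0
  have hJ := ContDiffOn.jacobian hU hf hk hg
  set J := jacobian f k g with hJ_def
  have hM : ContDiffOn ℝ ∞ (fun p => fderiv ℝ J p (crossGrad f g p)) U :=
    ContDiffOn.jacobian hU hf hJ hg
  have hM0 := ((hM.contDiffAt (hU.mem_nhds h0)).continuousAt).eventually_ne hJX0
  obtain ⟨V, hVsub, hV, h0V⟩ := mem_nhds_iff.1 ((hind.and hM0).and (hU.mem_nhds h0))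
  have hVU : V ⊆ U := fun p hp => (hVsub hp).2
  -- The derivative `J` of `σ₂` along the level lines serves as a provisional middle coordinate, so
  -- the critical set becomes the plane `q 1 = 0`.
  obtain ⟨ψ, hψ, hψeq⟩ := exists_coordinateChange_vec3 hV h0V (hf.mono hVU) (hJ.mono hVU)
    (hg.mono hVU) h1 hJ0 h3 hX0 hJX0
  have hψ0 : (0 : Fin 3 → ℝ) ∈ ψ.target := by
    simpa [hψ.map_zero] using ψ.map_source hψ.zero_mem
  obtain ⟨r, hr, hball⟩ := Metric.isOpen_iff.1 ψ.open_target 0 hψ0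
  have hsV {q : Fin 3 → ℝ} (hq : q ∈ Metric.ball 0 r) : ψ.symm q ∈ V :=
    hψ.source_subset (ψ.map_target (hball hq))
  set H : (Fin 3 → ℝ) → ℝ := fun q => k (ψ.symm q) with hH_def
  set m : (Fin 3 → ℝ) → ℝ :=
    fun q => (fderiv ℝ J (ψ.symm q) (crossGrad f g (ψ.symm q)))⁻¹ with hm_def
  have hψs : ContDiffOn ℝ ∞ ψ.symm (Metric.ball 0 r) := hψ.smooth_symm.mono hball
  have hH : ContDiffOn ℝ ∞ H (Metric.ball 0 r) := hk.comp hψs fun q hq => hVU (hsV hq)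
  have hm : ContDiffOn ℝ ∞ m (Metric.ball 0 r) :=
    (hM.comp hψs fun q hq => hVU (hsV hq)).inv fun q hq => (hVsub (hsV hq)).1.2
  have hdiff {F : (Fin 3 → ℝ) → ℝ} (hF : ContDiffOn ℝ ∞ F U) {p : Fin 3 → ℝ} (hp : p ∈ V) :
      DifferentiableAt ℝ F p :=
    (hF.contDiffAt (hU.mem_nhds (hVU hp))).differentiableAt (by simp)
  have hψval {q : Fin 3 → ℝ} (hq : q ∈ Metric.ball 0 r) :
      f (ψ.symm q) = q 0 ∧ J (ψ.symm q) = q 1 ∧ g (ψ.symm q) = q 2 := by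
    have h := ψ.right_inv (hball hq)
    rw [hψeq] at h
    exact ⟨congrFun h 0, congrFun h 1, congrFun h 2⟩
  have hchain {q : Fin 3 → ℝ} (hq : q ∈ Metric.ball 0 r) (w : Fin 3 → ℝ) :
      fderiv ℝ k (ψ.symm q) w = grad H q 0 * fderiv ℝ f (ψ.symm q) w
        + grad H q 1 * fderiv ℝ J (ψ.symm q) w + grad H q 2 * fderiv ℝ g (ψ.symm q) w := by
    have hp := ψ.map_target (hball hq)
    have hψd : DifferentiableAt ℝ ψ (ψ.symm q) :=
      (hψ.smooth.contDiffAt (ψ.open_source.mem_nhds hp)).differentiableAt (by simp)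
    have hHd : DifferentiableAt ℝ H (ψ (ψ.symm q)) := by
      rw [ψ.right_inv (hball hq)]
      exact (hH.contDiffAt (Metric.isOpen_ball.mem_nhds hq)).differentiableAt (by simp)
    have heq : k =ᶠ[𝓝 (ψ.symm q)] H ∘ ψ := by
      filter_upwards [ψ.open_source.mem_nhds hp] with p hp
      simp [H, ψ.left_inv hp]
    rw [heq.fderiv_eq, fderiv_comp _ hHd hψd, ψ.right_inv (hball hq)]
    rw [hψeq, ContinuousLinearMap.comp_apply, fderiv_vec3 (hdiff hf (hsV hq))
      (hdiff hJ (hsV hq)) (hdiff hg (hsV hq)), ← dotProduct_grad, dotProduct,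
      Fin.sum_univ_three]
    rfl
  -- Evaluate the chain rule on `X = ∇σ₁ × ∇σ₃`: it gives `J = ∂H/∂q₁ · dJ(X)`, whence the choice of
  -- `m`.
  have hmid {q : Fin 3 → ℝ} (hq : q ∈ Metric.ball 0 r) : grad H q 1 = q 1 * m q := by
    have h := hchain hq (crossGrad f g (ψ.symm q))
    rw [fderiv_left_crossGrad, fderiv_right_crossGrad] at h
    rw [hm_def, eq_mul_inv_iff_mul_eq₀ (hVsub (hsV hq)).1.2, ← (hψval hq).2.1, hJ_def, jacobian, h]
    ring
  have hrel {q : Fin 3 → ℝ} (hq : q ∈ Metric.ball 0 r) (hq1 : q 1 = 0) :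
      grad H q 0 * grad H q 2 = 1 ∧
        grad H q 0 ^ 2 - grad H q 0 * q 0 - grad H q 2 * q 2 = -H q := by
    have hpU := hVU (hsV hq)
    have := critical_relations (hVsub (hsV hq)).1.1 (hL.fderiv_one_comp hU hpU)
      (hL.fderiv_two_comp hU hpU) (hL.fderiv_three_comp hU hpU)
      (a := grad H q 0) (b := grad H q 2) fun v => by
        rw [← hk_def, hchain hq, hmid hq, hq1]; ring
    rwa [← hf_def, ← hg_def, (hψval hq).1, (hψval hq).2.2] at this
  obtain ⟨r', hr', hr'r, hplane⟩ := middle_plane_rigidity hr hH (fun q hq h => (hrel hq h).1)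
    fun q hq h => (hrel hq h).2
  have h0r : (0 : Fin 3 → ℝ) ∈ Metric.ball 0 r := Metric.mem_ball_self hr
  have h0r' : (0 : Fin 3 → ℝ) ∈ Metric.ball 0 (r' / 2) := Metric.mem_ball_self (half_pos hr')
  set c := grad H 0 0 with hc_def
  have hc : c ≠ 0 := left_ne_zero_of_mul_eq_one (hrel h0r rfl).1
  have hsub' : Metric.ball (0 : Fin 3 → ℝ) r' ⊆ Metric.ball 0 r := Metric.ball_subset_ball hr'r
  have hψsymm0 : ψ.symm 0 = 0 := by
    conv_lhs => rw [← hψ.map_zero, ψ.left_inv hψ.zero_mem]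
  have hHq {q : Fin 3 → ℝ} (hq : q ∈ Metric.ball 0 r') :
      H q = -c ^ 2 + c * q 0 + q 2 / c + q 1 ^ 2 * morseRemainder m q := by
    rw [eq_add_sq_mul_morseRemainder
      ((hH.mono hsub').differentiableOn (by simp)) (hm.mono hsub').continuousOn
      (fun q hq => hmid (hsub' hq)) hq, hplane (scaleMiddle 0 q) _ (by simp [scaleMiddle])]
    · simp [scaleMiddle]
    · rw [mem_ball_zero_iff] at hq ⊢
      exact (norm_scaleMiddle_le_self (by simp) q).trans_lt hq
  have hR : ContDiffOn ℝ ∞ (morseRemainder m) (Metric.ball 0 (r' / 2)) :=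
    contDiffOn_morseRemainder (hm.mono hsub')
  have hR0 : morseRemainder m 0 ≠ 0 := by
    rw [morseRemainder_zero, hm_def]
    simpa [hψsymm0] using hJX0
  obtain ⟨ε, hε, hεR⟩ : ∃ ε : ℝ, (ε = 1 ∨ ε = -1) ∧ 0 < ε * morseRemainder m 0 := by
    rcases hR0.lt_or_gt with h | h
    · exact ⟨-1, Or.inr rfl, by linarith⟩
    · exact ⟨1, Or.inl rfl, by linarith⟩
  have hεε : ε * ε = 1 := by rcases hε with rfl | rfl <;> norm_num
  set B := Metric.ball (0 : Fin 3 → ℝ) (r' / 2) ∩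
    (fun q => ε * morseRemainder m q) ⁻¹' Set.Ioi 0
  have hB : IsOpen B :=
    (continuousOn_const.mul hR.continuousOn).isOpen_inter_preimage Metric.isOpen_ball isOpen_Ioi
  set W := ψ.source ∩ ψ ⁻¹' B with hW_def
  have hW : IsOpen W := ψ.isOpen_inter_preimage hB
  have h0W : (0 : Fin 3 → ℝ) ∈ W := ⟨hψ.zero_mem, by
    rw [Set.mem_preimage, hψ.map_zero]; exact ⟨h0r', hεR⟩⟩
  have hWU : W ⊆ U := fun p hp => hVU (hψ.source_subset hp.1)
  -- The Morse coordinate is `y = Jρ`, so that `εy²` is the remainder term. Since `J(0) = 0`, its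
  -- derivative along `X` at `0` is `ρ(0)·dJ(X) ≠ 0`.
  set ρ : (Fin 3 → ℝ) → ℝ := fun p => √(ε * morseRemainder m (ψ p)) with hρ_def
  have hρ : ContDiffOn ℝ ∞ ρ W :=
    (contDiffOn_const.mul (hR.comp (hψ.smooth.mono fun p hp => hp.1)
      fun p hp => hp.2.1)).sqrt fun p hp => (ne_of_gt hp.2.2)
  have hy : ContDiffOn ℝ ∞ (fun p => J p * ρ p) W := (hJ.mono hWU).mul hρ
  have hyX : fderiv ℝ (fun p => J p * ρ p) 0 (crossGrad f g 0) ≠ 0 := by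
    have hρd : DifferentiableAt ℝ ρ 0 :=
      (hρ.contDiffAt (hW.mem_nhds h0W)).differentiableAt (by simp)
    have hρ0 : ρ 0 ≠ 0 := by
      rw [hρ_def]
      simpa [hψ.map_zero] using (Real.sqrt_pos.2 hεR).ne'
    rw [fderiv_fun_mul (hdiff hJ h0V) hρd, hJ0]
    simpa using ⟨hρ0, hJX0⟩
  obtain ⟨φ, hφ, hφeq⟩ := exists_coordinateChange_vec3 hW h0W (hf.mono hWU) hy (hg.mono hWU)
    h1 (by simp [hJ0]) h3 hX0 hyX
  refine ⟨c, ε, hc, ?_, hε, fun p => J p * ρ p, φ,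
    ⟨hφ.zero_mem, hφ.source_subset.trans hWU, hφ.map_zero, hφ.smooth, hφ.smooth_symm⟩, hφeq,
    hy.mono hφ.source_subset, fun p hp => ?_⟩
  · have := (hrel h0r rfl).2
    rw [← hc_def] at this
    simp only [H, hψsymm0, Pi.zero_apply] at this
    linarith
  · have hpW := hφ.source_subset hp
    have hq : ψ p ∈ Metric.ball (0 : Fin 3 → ℝ) r' :=
      Metric.ball_subset_ball (by linarith) hpW.2.1
    have h := hHq hq
    have hv := hψval (hsub' hq)
    simp only [H, ψ.left_inv hpW.1] at h hv
    rw [← hv.1, ← hv.2.1, ← hv.2.2] at h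
    have hρp : ρ p ^ 2 = ε * morseRemainder m (ψ p) := Real.sq_sqrt (le_of_lt hpW.2.2)
    rw [mul_pow, hρp, h]
    linear_combination -(J p ^ 2 * morseRemainder m (ψ p)) * hεε

end NormalForm

/-! ### The matrix of the operator -/

section MatrixForm

variable {L : (Fin 3 → ℝ) → (Fin 3 → ℝ) →L[ℝ] (Fin 3 → ℝ)} {U : Set (Fin 3 → ℝ)}

theorem IsNijenhuisOn.hasMatrixInCoordinates (hL : IsNijenhuisOn L U) (hU : IsOpen U)
    {c ε : ℝ} (hc : c ≠ 0) (hε : ε ≠ 0) {y : (Fin 3 → ℝ) → ℝ}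
    {φ : OpenPartialHomeomorph (Fin 3 → ℝ) (Fin 3 → ℝ)} (hφ : φ.source ⊆ U)
    (hφeq : ⇑φ = fun p => ![charInvariant L 1 p, y p, charInvariant L 3 p])
    (hy : ContDiffOn ℝ ∞ y φ.source)
    (hk : ∀ p ∈ φ.source, charInvariant L 2 p =
      ε * y p ^ 2 + c * charInvariant L 1 p + charInvariant L 3 p / c - c ^ 2) :
    HasMatrixInCoordinates L φ (fun q =>
      !![-q 0 + c, ε * (2 * q 1), 1 / c;
         -q 1 / 2, -c, 0;
         -q 2, 0, 0]) := by
  have hd {F : (Fin 3 → ℝ) → ℝ} {p : Fin 3 → ℝ} (hF : ContDiffOn ℝ ∞ F φ.source)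
      (hp : p ∈ φ.source) : DifferentiableAt ℝ F p :=
    (hF.contDiffAt (φ.open_source.mem_nhds hp)).differentiableAt (by simp)
  have hf := (contDiffOn_charInvariant_one hL.smooth).mono hφ
  have hg := (contDiffOn_charInvariant_three hL.smooth).mono hφ
  have hdk {p : Fin 3 → ℝ} (hp : p ∈ φ.source) (w : Fin 3 → ℝ) :
      fderiv ℝ (charInvariant L 2) p w = ε * (2 * y p) * fderiv ℝ y p w
        + c * fderiv ℝ (charInvariant L 1) p w + fderiv ℝ (charInvariant L 3) p w / c := by
    have heq : charInvariant L 2 =ᶠ[𝓝 p] fun p =>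
        ε * y p ^ 2 + c * charInvariant L 1 p + c⁻¹ * charInvariant L 3 p - c ^ 2 := by
      filter_upwards [φ.open_source.mem_nhds hp] with q hq
      rw [hk q hq]; ring
    have h := (((((hd hy hp).hasFDerivAt.pow 2).const_mul ε).add
      ((hd hf hp).hasFDerivAt.const_mul c)).add
      ((hd hg hp).hasFDerivAt.const_mul c⁻¹)).sub_const (c ^ 2)
    rw [heq.fderiv_eq]
    refine (congrArg (fun T => T w) h.fderiv).trans ?_
    simp
    ring
  -- `R` is the defect in the second row. The formula for `L^*dσ₂` only shows `y·R = 0`.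
  set R : (Fin 3 → ℝ) → (Fin 3 → ℝ) → ℝ := fun v p => fderiv ℝ y p (L p v)
    + y p / 2 * fderiv ℝ (charInvariant L 1) p v + c * fderiv ℝ y p v with hR_def
  have hyR {p : Fin 3 → ℝ} (hp : p ∈ φ.source) (v : Fin 3 → ℝ) : y p * R v p = 0 := by
    have h1 := hL.fderiv_one_comp hU (hφ hp) v
    have h2 := hL.fderiv_two_comp hU (hφ hp) v
    have h3 := hL.fderiv_three_comp hU (hφ hp) v
    rw [hdk hp, h1, h3, hdk hp, hk p hp] at h2
    have : 2 * ε * (y p * R v p) = 0 := by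
      simp only [hR_def]
      refine mul_left_cancel₀ hc ?_
      field_simp at h2
      linear_combination h2
    simpa [hε] using this
  have hRcont (v : Fin 3 → ℝ) : ContinuousOn (R v) φ.source := by
    have hdy := hy.fderiv_of_isOpen (m := ∞) φ.open_source (by simp)
    have hdf := hf.fderiv_of_isOpen (m := ∞) φ.open_source (by simp)
    have hLv := (hL.smooth.mono hφ).clm_apply (contDiffOn_const (c := v))
    exact (((hdy.clm_apply hLv).add ((hy.div_const 2).mul
      (hdf.clm_apply contDiffOn_const))).add
        (contDiffOn_const.mul (hdy.clm_apply contDiffOn_const))).continuousOn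
  have hRzero {p : Fin 3 → ℝ} (hp : p ∈ φ.source) (v : Fin 3 → ℝ) : R v p = 0 := by
    by_contra hne
    -- If `R` were nonzero at `p`, then by continuity `y` would vanish near `p`, hence also `dy` and
    -- `R` at `p`.
    have hnear : y =ᶠ[𝓝 p] fun _ => 0 := by
      filter_upwards [((hRcont v).continuousAt (φ.open_source.mem_nhds hp)).eventually_ne hne,
        φ.open_source.mem_nhds hp] with q hq hqs
      exact (mul_eq_zero.1 (hyR hqs v)).resolve_right hq
    refine hne ?_
    simp [hR_def, hnear.fderiv_eq, hnear.self_of_nhds]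
  intro p hp v
  have hRp := hRzero hp v
  simp only [hR_def] at hRp
  simp only [hφeq]
  rw [fderiv_vec3 (hd hf hp) (hd hy hp) (hd hg hp), fderiv_vec3 (hd hf hp) (hd hy hp) (hd hg hp),
    hL.fderiv_one_comp hU (hφ hp), hL.fderiv_three_comp hU (hφ hp), hdk hp]
  ext i
  fin_cases i
  · simp [Matrix.mulVec, dotProduct, Fin.sum_univ_three]; ring
  · simp [Matrix.mulVec, dotProduct, Fin.sum_univ_three]; linarith
  · simp [Matrix.mulVec, dotProduct, Fin.sum_univ_three]

end MatrixForm

theorem theorem4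
    (U : Set (Fin 3 → ℝ)) (hU : IsOpen U) (h0 : (0 : Fin 3 → ℝ) ∈ U)
    (L : (Fin 3 → ℝ) → (Fin 3 → ℝ) →L[ℝ] (Fin 3 → ℝ)) (hL : IsNijenhuisOn L U)
    (hind : ∀ᶠ p in 𝓝 (0 : Fin 3 → ℝ),
      LinearIndependent ℝ ![fderiv ℝ (charInvariant L 1) p, fderiv ℝ (charInvariant L 3) p])
    (h1 : charInvariant L 1 0 = 0) (h3 : charInvariant L 3 0 = 0)
    (hMorse : HasMorseSingularityOnCurve (charInvariant L 2)
      {p | p ∈ U ∧ charInvariant L 1 p = 0 ∧ charInvariant L 3 p = 0} 0) :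
    (0 ≤ charInvariant L 2 0 → False) ∧
    ∀ d : ℝ, d ≠ 0 → charInvariant L 2 0 = -d ^ 2 →
      ∃ c ε : ℝ, (c = d ∨ c = -d) ∧ (ε = 1 ∨ ε = -1) ∧
        ∃ φ : OpenPartialHomeomorph (Fin 3 → ℝ) (Fin 3 → ℝ), IsCoordinateChange φ U ∧
          HasMatrixInCoordinates L φ (fun q =>
            !![-q 0 + c, ε * (2 * q 1), 1 / c;
               -q 1 / 2, -c, 0;
               -q 2, 0, 0]) ∧
          ∀ p ∈ φ.source,
            LinearMap.charpoly (L p : (Fin 3 → ℝ) →ₗ[ℝ] (Fin 3 → ℝ)) =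
              Polynomial.X ^ 3 + Polynomial.C (φ p 0) * Polynomial.X ^ 2
                + Polynomial.C (ε * φ p 1 ^ 2 + c * φ p 0 + φ p 2 / c - c ^ 2) * Polynomial.X
                + Polynomial.C (φ p 2) := by
  obtain ⟨c, ε, hc, hc2, hε, y, φ, hφ, hφeq, hy, hk⟩ :=
    hL.exists_coordinates hU h0 hind h1 h3 hMorse
  have hcpos : 0 < c ^ 2 := by positivity
  refine ⟨fun h => by linarith, fun d _ hd => ⟨c, ε, ?_, hε, φ, hφ, ?_, fun p hp => ?_⟩⟩
  · exact sq_eq_sq_iff_eq_or_eq_neg.1 (by linarith)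
  · exact hL.hasMatrixInCoordinates hU hc (by rcases hε with rfl | rfl <;> norm_num)
      hφ.source_subset hφeq hy hk
  · rw [charpoly_eq_charInvariant, hk p hp, hφeq]
    rfl
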